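/- Let $\mathbb{F}_q$ be a finite field, $A=\mathbb{F}_q[\theta]$, $K_\infty=\mathbb{F}_q((1/\theta))$, and let $\mathbb{C}_\infty$ be the completion of an algebraic closure of $K_\infty$, with absolute value normalized by $|\theta|=q$. Let $\mathbb{T}_s$ be the Tate algebra of power series $\sum_\nu a_\nu \underline{t}^\nu\in\mathbb{C}_\infty[[t_1,\dots,t_s]]$ with $|a_\nu|\to 0$, with the Gauss norm $\|\cdot\|$, the twisting automorphism $\tau(\sum a_\nu\underline{t}^\nu)=\sum a_\nu^q\underline{t}^\nu$ and $f^{(n)}=\tau^n(f)$ for $n\in\mathbb{Z}$. Let $\mathbb{T}_s\{z/\theta\}$ be the ring of power series $\sum_i a_iz^i\in\mathbb{T}_s[[z]]$ with $|\theta|^i\|a_i\|\to0$; twisting acts on power series in $z$ coefficientwise. Let $\phi\colon A[t_1,\dots,t_s]\to\mathbb{T}_s[\tau]$ be a Drinfeld $A[t_1,\dots,t_s]$-module of rank $r\geqslant 1$, that is, a homomorphism of $\mathbb{F}_q[t_1,\dots,t_s]$-algebras into the twisted polynomial ring (with $\tau f=f^{(1)}\tau$) such that $$\phi_\theta=\theta+A_1\tau+\cdots+A_r\tau^r,\qquad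 A_i\in\mathbb{T}_s,$$ and assume that $A_r\in\mathbb{T}_s^\times$. Let $\exp_\phi=\sum_{i\geqslant0}\alpha_i\tau^i\in\mathbb{T}_s[[\tau]]$ be its exponential series, the unique series with $\alpha_0=1$ and $\exp_\phi a=\phi_a\exp_\phi$ for all $a\in A[t_1,\dots,t_s]$. Let $H(\phi)=\mathbb{T}_s[\sigma]$, $\sigma=\tau^{-1}$, be the Frobenius module of $\phi$, on which $\mathbb{T}_s[z]$ acts by $cz\cdot h=ch\,(\theta+A_1^{(-1)}\sigma+\cdots+A_r^{(-r)}\sigma^r)$. Let $\iota\colon\mathbb{T}_s[z]^r\to H(\phi)$ be the map $(h_1,\dots,h_r)\mapsto\sum_j h_j\cdot\sigma^{j-1}$ given by the $\mathbb{T}_s[z]$-basis $1,\sigma,\dots,\sigma^{r-1}$ of $H(\phi)$, and let $$\Phi=\begin{pmatrix}0&1&\cdots&0\\ \vdots&\vdots&\ddots&\vdots\\ 0&0&\cdots&1\\ \dfrac{z-\theta}{A_r^{(-r)}}&-\dfrac{A_1^{(-1)}}{A_r^{(-r)}}&\cdots&-\dfrac{A_{r-1}^{(-r+1)}}{A_r^{(-r)}}\end{pmatrix}\in\mathrm{Mat}_r(\mathbb{T}_s[z])$$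 be the matrix that represents multiplication by $\sigma$ with respect to this basis. A rigid analytic trivialization of $\phi$ is a triple $(\iota,\Phi,\Psi)$ with these $\iota$ and $\Phi$ and with a matrix $\Psi\in\mathrm{GL}_r(\mathbb{T}_s\{z/\theta\})$ such that $\Psi^{(-1)}=\Phi\Psi$. If $\phi$ has a rigid analytic trivialization $(\iota,\Phi,\Psi)$, then $\phi$ is uniformizable: the series $\exp_\phi(f)=\sum_{i\geqslant0}\alpha_i f^{(i)}$ converges for every $f\in\mathbb{T}_s$, and the function $\exp_\phi\colon\mathbb{T}_s\to\mathbb{T}_s$ is surjective. -/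

import Mathlib

open Filter Topology
open scoped NNReal WithZero

noncomputable section

namespace DrinfeldTate

/-! ### The fields `K_∞` and `ℂ_∞` -/

section Field

variable (Fq : Type*) [Field Fq] [Fintype Fq]

lemma one_lt_card : (1 : ℝ≥0) < Fintype.card Fq := by
  exact_mod_cast Fintype.one_lt_card

lemma card_ne_zero' : (Fintype.card Fq : ℝ≥0) ≠ 0 := (one_lt_card Fq).ne_bot

open Classical in
/-- The `∞`-adic absolute value on `K = Fq(θ)`, normalized so that `|θ| = q`. -/
def absInfty : AbsoluteValue (RatFunc Fq) ℝ where
  toFun f := WithZeroMulInt.toNNReal (card_ne_zero' Fq) (RatFunc.inftyValuation Fq f)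
  map_mul' f g := by simp
  nonneg' f := NNReal.coe_nonneg _
  eq_zero' f := by simp
  add_le' f g := by
    have h1 := (RatFunc.inftyValuation Fq).map_add f g
    have hm := (WithZeroMulInt.toNNReal_strictMono (one_lt_card Fq)).monotone
    have h2 := hm h1
    rw [hm.map_max] at h2
    exact_mod_cast h2.trans (max_le_add_of_nonneg (by simp) (by simp))

open Classical in
lemma absInfty_apply (f : RatFunc Fq) : absInfty Fq f =
    WithZeroMulInt.toNNReal (card_ne_zero' Fq) (RatFunc.inftyValuation Fq f) := rfl

lemma absInfty_add_le_max (f g : RatFunc Fq) :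
    absInfty Fq (f + g) ≤ max (absInfty Fq f) (absInfty Fq g) := by
  classical
  have h1 := (RatFunc.inftyValuation Fq).map_add f g
  have hm := (WithZeroMulInt.toNNReal_strictMono (one_lt_card Fq)).monotone
  have h2 := hm h1
  rw [hm.map_max] at h2
  simp only [absInfty_apply]
  exact_mod_cast h2

lemma absInfty_X : absInfty Fq RatFunc.X = Fintype.card Fq := by
  classical
  rw [absInfty_apply, RatFunc.inftyValuation.X,
    WithZeroMulInt.toNNReal_neg_apply _ WithZero.exp_ne_zero]
  have : WithZero.unzero (WithZero.exp_ne_zero (a := (1 : ℤ))) = Multiplicative.ofAdd 1 := rfl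
  simp [this]

/-- `K_∞`: the completion of `K = Fq(θ)` at the infinite place. -/
abbrev KInfty : Type _ := (absInfty Fq).Completion

/-- The completion of an ultrametric normed field is ultrametric. -/
lemma isUltrametricDist_completion (L : Type*) [NormedField L] [IsUltrametricDist L] :
    IsUltrametricDist (UniformSpace.Completion L) := by
  refine IsUltrametricDist.isUltrametricDist_of_forall_norm_add_le_max_norm fun x y => ?_
  induction x, y using UniformSpace.Completion.induction_on₂ with
  | hp => exact isClosed_le (by fun_prop) (by fun_prop)
  | ih x y =>
    rw [← UniformSpace.Completion.coe_add]
    simpa only [UniformSpace.Completion.norm_coe] using IsUltrametricDist.norm_add_le_max x y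

instance : IsUltrametricDist (WithAbs (absInfty Fq)) :=
  IsUltrametricDist.isUltrametricDist_of_forall_norm_add_le_max_norm fun _ _ =>
    absInfty_add_le_max Fq _ _

instance : IsUltrametricDist (KInfty Fq) := isUltrametricDist_completion _

instance : NontriviallyNormedField (KInfty Fq) where
  non_trivial := ⟨((WithAbs.toAbs (absInfty Fq) RatFunc.X : WithAbs (absInfty Fq)) : KInfty Fq), by
    rw [UniformSpace.Completion.norm_coe]
    change 1 < absInfty Fq RatFunc.X
    rw [absInfty_X]
    exact_mod_cast Fintype.one_lt_card⟩

/-- An algebraic closure of `K_∞`, with the unique extension of the absolute value. -/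
abbrev KInftyBar : Type _ := AlgebraicClosure (KInfty Fq)

instance : NormedField (KInftyBar Fq) := spectralNorm.normedField (KInfty Fq) (KInftyBar Fq)

instance : NormedAlgebra (KInfty Fq) (KInftyBar Fq) := spectralNorm.normedAlgebra _ _

instance : IsUltrametricDist (KInftyBar Fq) :=
  IsUltrametricDist.isUltrametricDist_of_forall_norm_add_le_max_norm
    (isNonarchimedean_spectralNorm (K := KInfty Fq) (L := KInftyBar Fq))

/-- `ℂ_∞`: the completion of an algebraic closure of `K_∞`. -/
abbrev CInfty : Type _ := UniformSpace.Completion (KInftyBar Fq)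

instance : NormedField (CInfty Fq) := inferInstance

instance : NormedRing (CInfty Fq) := inferInstance

instance : CommRing (CInfty Fq) := inferInstance

instance : IsUltrametricDist (CInfty Fq) := isUltrametricDist_completion _

/-- The embedding `K = Fq(θ) → ℂ_∞`. -/
def ofK : RatFunc Fq →+* CInfty Fq :=
  (UniformSpace.Completion.coeRingHom (α := KInftyBar Fq)).comp
    ((algebraMap (KInfty Fq) (KInftyBar Fq)).comp
      ((UniformSpace.Completion.coeRingHom (α := WithAbs (absInfty Fq))).comp
        (WithAbs.equiv (absInfty Fq)).symm.toRingHom))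

lemma norm_ofK (f : RatFunc Fq) : ‖ofK Fq f‖ = absInfty Fq f := by
  change ‖((algebraMap (KInfty Fq) (KInftyBar Fq)
    ((WithAbs.toAbs (absInfty Fq) f : WithAbs (absInfty Fq)) : KInfty Fq) : KInftyBar Fq) :
      CInfty Fq)‖ = _
  rw [UniformSpace.Completion.norm_coe, norm_algebraMap', UniformSpace.Completion.norm_coe]
  rfl

/-- The embedding `A = Fq[θ] → ℂ_∞`. -/
def ofA : Polynomial Fq →+* CInfty Fq := (ofK Fq).comp (algebraMap (Polynomial Fq) (RatFunc Fq))

/-- The `q`-th power map of `ℂ_∞`, a ring endomorphism since `ℂ_∞` contains `Fq`. -/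
def frobHom : CInfty Fq →+* CInfty Fq :=
  letI : Algebra Fq (CInfty Fq) := ((ofA Fq).comp Polynomial.C).toAlgebra
  (FiniteField.frobeniusAlgHom Fq (CInfty Fq)).toRingHom

lemma frobHom_apply (x : CInfty Fq) : frobHom Fq x = x ^ Fintype.card Fq := by
  simp [frobHom]

lemma norm_frobHom (x : CInfty Fq) : ‖frobHom Fq x‖ = ‖x‖ ^ Fintype.card Fq := by
  rw [frobHom_apply, norm_pow]

lemma frobHom_surjective : Function.Surjective (frobHom Fq) := by
  have hq : Fintype.card Fq ≠ 0 := Fintype.card_ne_zero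
  have hd (x y : CInfty Fq) :
      dist (frobHom Fq x) (frobHom Fq y) = dist x y ^ Fintype.card Fq := by
    rw [dist_eq_norm, ← map_sub, norm_frobHom, dist_eq_norm]
  have hu : IsUniformInducing (frobHom Fq) := by
    rw [Metric.isUniformInducing_iff]
    refine ⟨Metric.uniformContinuous_iff.mpr fun ε hε => ⟨min ε 1, by positivity, ?_⟩,
      fun δ hδ => ⟨δ ^ Fintype.card Fq, by positivity, ?_⟩⟩
    · intro a b hab
      rw [hd]
      calc dist a b ^ Fintype.card Fq ≤ dist a b :=
            pow_le_of_le_one dist_nonneg (hab.le.trans (min_le_right _ _)) hq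
        _ < ε := hab.trans_le (min_le_left _ _)
    · intro a b hab
      rw [hd] at hab
      exact lt_of_pow_lt_pow_left₀ _ hδ.le hab
  have hc : IsClosed (Set.range (frobHom Fq)) := hu.isComplete_range.isClosed
  have hdense : Dense (Set.range (frobHom Fq)) := by
    refine (UniformSpace.Completion.denseRange_coe (α := KInftyBar Fq)).mono ?_
    rintro _ ⟨a, rfl⟩
    obtain ⟨b, hb⟩ := IsAlgClosed.exists_pow_nat_eq a (Nat.pos_of_ne_zero hq)
    refine ⟨(b : CInfty Fq), ?_⟩
    rw [frobHom_apply, ← hb]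
    exact (map_pow (UniformSpace.Completion.coeRingHom (α := KInftyBar Fq)) b _).symm
  rw [← Set.range_eq_univ, ← hc.closure_eq, hdense.closure_eq]

/-- The `q`-th power Frobenius automorphism of `ℂ_∞`. -/
def frob : CInfty Fq ≃+* CInfty Fq :=
  RingEquiv.ofBijective (frobHom Fq) ⟨(frobHom Fq).injective, frobHom_surjective Fq⟩

lemma frob_apply (x : CInfty Fq) : frob Fq x = x ^ Fintype.card Fq := frobHom_apply Fq x

lemma norm_frob (x : CInfty Fq) : ‖frob Fq x‖ = ‖x‖ ^ Fintype.card Fq := norm_frobHom Fq x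

lemma norm_frob_symm (x : CInfty Fq) : ‖(frob Fq).symm x‖ ^ Fintype.card Fq = ‖x‖ := by
  rw [← norm_frob, RingEquiv.apply_symm_apply]

end Field

/-! ### Tate algebras -/

section Tate

variable (Fq : Type*) [Field Fq] [Fintype Fq] (s : ℕ)

/-- The Tate algebra `𝕋_s`: power series in `t_1, …, t_s` over `ℂ_∞` whose coefficients tend
to zero. -/
abbrev Tate : Type _ :=
  MvPowerSeries.IsRestricted.subring (R := CInfty Fq) (fun _ : Fin s => (1 : ℝ))

variable {Fq s}

lemma isRestricted_one_iff {f : MvPowerSeries (Fin s) (CInfty Fq)} :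
    MvPowerSeries.IsRestricted (fun _ : Fin s => (1 : ℝ)) f ↔
      Tendsto (fun ν => ‖MvPowerSeries.coeff ν f‖) cofinite (𝓝 0) := by
  simp [MvPowerSeries.IsRestricted]

lemma Tate.tendsto_coeff (f : Tate Fq s) :
    Tendsto (fun ν => ‖MvPowerSeries.coeff ν f.1‖) cofinite (𝓝 0) :=
  isRestricted_one_iff.mp f.2

lemma Tate.hasGaussNorm (f : Tate Fq s) :
    MvPowerSeries.HasGaussNorm (fun x : CInfty Fq => ‖x‖) (fun _ : Fin s => (1 : ℝ)) f.1 := by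
  have h := (show MvPowerSeries.IsRestricted (fun _ : Fin s => (1 : ℝ)) f.1 from f.2)
  exact Tendsto.bddAbove_range_of_cofinite h

variable (Fq s)

/-- The Gauss norm `‖f‖ = sup_ν |a_ν|` on `𝕋_s`. -/
def gaussRingNorm : RingNorm (Tate Fq s) where
  toFun f := MvPowerSeries.gaussNorm (fun x : CInfty Fq => ‖x‖) (fun _ : Fin s => (1 : ℝ)) f.1
  map_zero' := MvPowerSeries.gaussNorm_zero _ _ norm_zero
  add_le' f g := by
    refine (MvPowerSeries.gaussNorm_add_le_max (fun x : CInfty Fq => ‖x‖) _ _ _ (fun _ => zero_le_one)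
      (fun _ => norm_nonneg _) IsUltrametricDist.norm_add_le_max f.hasGaussNorm
      g.hasGaussNorm).trans (max_le_add_of_nonneg ?_ ?_) <;>
    exact MvPowerSeries.gaussNorm_nonneg _ _ _ fun _ => norm_nonneg _
  neg' f := MvPowerSeries.gaussNorm_neg _ _ norm_neg f.1
  mul_le' f g := MvPowerSeries.gaussNorm_mul_le (fun x : CInfty Fq => ‖x‖) _ _ _ (fun _ => zero_le_one)
    (fun _ => norm_nonneg _) (fun _ _ => norm_mul_le _ _) IsUltrametricDist.norm_add_le_max
    norm_zero f.hasGaussNorm g.hasGaussNorm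
  eq_zero_of_map_eq_zero' f hf := Subtype.ext <|
    (MvPowerSeries.gaussNorm_eq_zero_iff _ _ _ norm_zero (fun _ => norm_nonneg _)
      (fun _ => norm_eq_zero.mp) (fun _ => one_pos) f.hasGaussNorm).mp hf

instance : NormedCommRing (Tate Fq s) where
  __ := RingNorm.toNormedRing (gaussRingNorm Fq s)
  mul_comm := mul_comm

instance : CommRing (Tate Fq s) := inferInstance

instance : NormedRing (Tate Fq s) := inferInstance

lemma Tate.norm_def (f : Tate Fq s) : ‖f‖ =
    MvPowerSeries.gaussNorm (fun x : CInfty Fq => ‖x‖) (fun _ : Fin s => (1 : ℝ)) f.1 := rfl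

instance : IsUltrametricDist (Tate Fq s) :=
  IsUltrametricDist.isUltrametricDist_of_forall_norm_add_le_max_norm fun f g =>
    MvPowerSeries.gaussNorm_add_le_max (fun x : CInfty Fq => ‖x‖) _ _ _ (fun _ => zero_le_one)
      (fun _ => norm_nonneg _) IsUltrametricDist.norm_add_le_max f.hasGaussNorm g.hasGaussNorm

/-- The Frobenius twist `τ(∑ a_ν t^ν) = ∑ a_ν^q t^ν`, an automorphism of `𝕋_s`.  Its integral
powers are the twists `f ↦ f^{(n)}`. -/
def tau : RingAut (Tate Fq s) where
  toFun f := ⟨MvPowerSeries.map (frob Fq).toRingHom f.1, by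
    refine isRestricted_one_iff.mpr ?_
    have h := f.tendsto_coeff.pow (Fintype.card Fq)
    rw [zero_pow Fintype.card_ne_zero] at h
    refine h.congr fun ν => ?_
    rw [MvPowerSeries.coeff_map]
    exact (norm_frob Fq _).symm⟩
  invFun f := ⟨MvPowerSeries.map (frob Fq).symm.toRingHom f.1, by
    refine isRestricted_one_iff.mpr ?_
    have h := f.tendsto_coeff.rpow_const (p := ((Fintype.card Fq : ℝ)⁻¹)) (Or.inr (by positivity))
    rw [Real.zero_rpow (by simp)] at h
    refine h.congr fun ν => ?_
    rw [MvPowerSeries.coeff_map, ← norm_frob_symm]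
    exact Real.pow_rpow_inv_natCast (norm_nonneg _) Fintype.card_ne_zero⟩
  left_inv f := by
    refine Subtype.ext (MvPowerSeries.ext fun ν => ?_)
    simp
  right_inv f := by
    refine Subtype.ext (MvPowerSeries.ext fun ν => ?_)
    simp
  map_mul' f g := Subtype.ext (map_mul _ f.1 g.1)
  map_add' f g := Subtype.ext (map_add _ f.1 g.1)

lemma coeff_tau (f : Tate Fq s) (ν : Fin s →₀ ℕ) :
    MvPowerSeries.coeff ν (tau Fq s f).1 = MvPowerSeries.coeff ν f.1 ^ Fintype.card Fq := by
  rw [← frob_apply]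
  exact MvPowerSeries.coeff_map _ _ _

/-- The constants `ℂ_∞ → 𝕋_s`. -/
def Tate.const : CInfty Fq →+* Tate Fq s :=
  (MvPowerSeries.C (σ := Fin s) (R := CInfty Fq)).codRestrict _
    fun a => MvPowerSeries.isRestricted_C _ a

/-- The variable `t_i` in `𝕋_s`. -/
def Tate.var (i : Fin s) : Tate Fq s :=
  ⟨MvPowerSeries.X i, MvPowerSeries.isRestricted_monomial _ _ _⟩

/-- The inclusion `A[t_1, …, t_s] → 𝕋_s`. -/
def ofAts : MvPolynomial (Fin s) (Polynomial Fq) →+* Tate Fq s :=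
  MvPolynomial.eval₂Hom ((Tate.const Fq s).comp (ofA Fq)) (Tate.var Fq s)

/-- The element `θ` of `A[t_1, …, t_s]`. -/
def thetaA : MvPolynomial (Fin s) (Polynomial Fq) := MvPolynomial.C Polynomial.X

/-- The element `θ` of `𝕋_s`. -/
def theta : Tate Fq s := ofAts Fq s (thetaA Fq s)

/-- The inclusion `Fq[t_1, …, t_s] → A[t_1, …, t_s]`. -/
def ofFqts : MvPolynomial (Fin s) Fq →+* MvPolynomial (Fin s) (Polynomial Fq) :=
  MvPolynomial.map Polynomial.C

variable {Fq s}

/-- The Tate algebra `𝕋_s{z/c}`: power series `∑ a_i z^i` over `𝕋_s` with `‖c‖^i ‖a_i‖ → 0`. -/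
abbrev TateZ (c : Tate Fq s) : Type _ := PowerSeries.IsRestricted.subring (R := Tate Fq s) ‖c‖

end Tate

/-! ### Twisted power series and twisted polynomials -/

/-- The twisted power series ring `R[[τ]]`, with `τ f = τ(f) τ` for `f ∈ R`. -/
def TwistedPowerSeries (R : Type*) [CommRing R] (_τ : RingAut R) : Type _ := ℕ → R

namespace TwistedPowerSeries

open Finset

variable {R : Type*} [CommRing R] {τ : RingAut R}

instance : AddCommGroup (TwistedPowerSeries R τ) := inferInstanceAs (AddCommGroup (ℕ → R))

/-- The coefficient of `τ^n`. -/
def coeff (n : ℕ) (f : TwistedPowerSeries R τ) : R := f n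

/-- The series `∑ a_i τ^i`. -/
def mk (τ : RingAut R) (a : ℕ → R) : TwistedPowerSeries R τ := a

@[ext] lemma ext {f g : TwistedPowerSeries R τ} (h : ∀ n, coeff n f = coeff n g) : f = g :=
  funext h

@[simp] lemma coeff_mk (n : ℕ) (a : ℕ → R) : coeff n (mk τ a) = a n := rfl

@[simp] lemma coeff_zero (n : ℕ) : coeff n (0 : TwistedPowerSeries R τ) = 0 := rfl

@[simp] lemma coeff_add (n : ℕ) (f g : TwistedPowerSeries R τ) :
    coeff n (f + g) = coeff n f + coeff n g := rfl

@[simp] lemma coeff_neg (n : ℕ) (f : TwistedPowerSeries R τ) :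
    coeff n (-f) = -coeff n f := rfl

instance : Mul (TwistedPowerSeries R τ) :=
  ⟨fun f g => mk τ fun n => ∑ p ∈ antidiagonal n, coeff p.1 f * (τ ^ p.1) (coeff p.2 g)⟩

instance : One (TwistedPowerSeries R τ) := ⟨mk τ fun n => if n = 0 then 1 else 0⟩

lemma coeff_mul (n : ℕ) (f g : TwistedPowerSeries R τ) :
    coeff n (f * g) = ∑ p ∈ antidiagonal n, coeff p.1 f * (τ ^ p.1) (coeff p.2 g) := rfl

lemma coeff_one (n : ℕ) : coeff n (1 : TwistedPowerSeries R τ) = if n = 0 then 1 else 0 := rfl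

instance : Ring (TwistedPowerSeries R τ) where
  __ := (inferInstance : AddCommGroup (TwistedPowerSeries R τ))
  left_distrib f g h := by
    ext n; simp only [coeff_mul, coeff_add, map_add, mul_add, sum_add_distrib]
  right_distrib f g h := by
    ext n; simp only [coeff_mul, coeff_add, add_mul, sum_add_distrib]
  zero_mul f := by ext n; simp [coeff_mul]
  mul_zero f := by ext n; simp [coeff_mul]
  one_mul f := by
    ext n
    rw [coeff_mul, sum_eq_single (0, n)]
    · simp [coeff_one]
    · rintro ⟨i, j⟩ hij hne
      have : i ≠ 0 := by rintro rfl; simp_all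
      simp [coeff_one, this]
    · simp
  mul_one f := by
    ext n
    rw [coeff_mul, sum_eq_single (n, 0)]
    · simp [coeff_one]
    · rintro ⟨i, j⟩ hij hne
      have : j ≠ 0 := by rintro rfl; simp_all
      simp [coeff_one, this]
    · simp
  mul_assoc f g h := by
    ext n
    simp only [coeff_mul, sum_mul, map_sum, mul_sum]
    rw [sum_sigma', sum_sigma']
    refine sum_nbij' (fun ⟨⟨_, j⟩, ⟨k, l⟩⟩ => ⟨(k, l + j), (l, j)⟩)
      (fun ⟨⟨i, _⟩, ⟨k, l⟩⟩ => ⟨(i + k, l), (i, k)⟩) ?_ ?_ ?_ ?_ ?_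
    · rintro ⟨⟨i, j⟩, ⟨k, l⟩⟩ hm
      simp only [mem_sigma, HasAntidiagonal.mem_antidiagonal, and_true] at hm ⊢
      omega
    · rintro ⟨⟨i, j⟩, ⟨k, l⟩⟩ hm
      simp only [mem_sigma, HasAntidiagonal.mem_antidiagonal, and_true] at hm ⊢
      omega
    · rintro ⟨⟨i, j⟩, ⟨k, l⟩⟩ hm
      simp at hm ⊢
      grind
    · rintro ⟨⟨i, j⟩, ⟨k, l⟩⟩ hm
      simp at hm ⊢
      grind
    · rintro ⟨⟨i, j⟩, ⟨k, l⟩⟩ hm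
      simp only [mem_sigma, HasAntidiagonal.mem_antidiagonal] at hm
      simp only [← hm.2, map_mul, pow_add, RingAut.mul_apply, mul_assoc]

/-- The constants `R → R[[τ]]`. -/
def C (τ : RingAut R) : R →+* TwistedPowerSeries R τ where
  toFun a := mk τ fun n => if n = 0 then a else 0
  map_zero' := by ext n; simp
  map_one' := rfl
  map_add' a b := by ext n; by_cases h : n = 0 <;> simp [h]
  map_mul' a b := by
    ext n
    rw [coeff_mul]
    by_cases h : n = 0
    · subst h; simp
    · rw [sum_eq_zero]
      · simp [h]
      · rintro ⟨i, j⟩ hij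
        by_cases hi : i = 0
        · have : j ≠ 0 := by rintro rfl; simp_all
          simp [this]
        · simp [hi]

lemma coeff_C (n : ℕ) (a : R) : coeff n (C τ a) = if n = 0 then a else 0 := rfl

lemma coeff_C_mul (n : ℕ) (a : R) (f : TwistedPowerSeries R τ) :
    coeff n (C τ a * f) = a * coeff n f := by
  rw [coeff_mul, sum_eq_single (0, n)]
  · simp [coeff_C]
  · rintro ⟨i, j⟩ hij hne
    have : i ≠ 0 := by rintro rfl; simp_all
    simp [coeff_C, this]
  · simp

lemma coeff_mul_C (n : ℕ) (a : R) (f : TwistedPowerSeries R τ) :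
    coeff n (f * C τ a) = coeff n f * (τ ^ n) a := by
  rw [coeff_mul, sum_eq_single (n, 0)]
  · simp [coeff_C]
  · rintro ⟨i, j⟩ hij hne
    have : j ≠ 0 := by rintro rfl; simp_all
    simp [coeff_C, this]
  · simp

variable (R τ) in
/-- The twisted polynomial ring `R[τ]`: the series with finitely many nonzero coefficients. -/
def polynomials : Subring (TwistedPowerSeries R τ) where
  carrier := {f | ∃ d, ∀ n, d < n → coeff n f = 0}
  zero_mem' := ⟨0, fun _ _ => rfl⟩
  one_mem' := ⟨0, fun n hn => by simp [coeff_one, hn.ne']⟩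
  add_mem' := by
    rintro f g ⟨d, hd⟩ ⟨e, he⟩
    exact ⟨max d e, fun n hn => by
      simp [hd n ((le_max_left _ _).trans_lt hn), he n ((le_max_right _ _).trans_lt hn)]⟩
  neg_mem' := by
    rintro f ⟨d, hd⟩
    exact ⟨d, fun n hn => by simp [hd n hn]⟩
  mul_mem' := by
    rintro f g ⟨d, hd⟩ ⟨e, he⟩
    refine ⟨d + e, fun n hn => ?_⟩
    rw [coeff_mul, sum_eq_zero]
    rintro ⟨i, j⟩ hij
    rw [HasAntidiagonal.mem_antidiagonal] at hij
    dsimp only at hij ⊢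
    rcases lt_or_ge d i with h | h
    · simp [hd i h]
    · simp [he j (by omega)]

end TwistedPowerSeries

/-- The twisted polynomial ring `R[τ]`. -/
abbrev TwistedPolynomial (R : Type*) [CommRing R] (τ : RingAut R) : Type _ :=
  TwistedPowerSeries.polynomials R τ

namespace TwistedPolynomial

variable {R : Type*} [CommRing R] {τ : RingAut R}

/-- The coefficient of `τ^n`. -/
def coeff (n : ℕ) (f : TwistedPolynomial R τ) : R := TwistedPowerSeries.coeff n f.1

/-- The constants `R → R[τ]`. -/
def C (τ : RingAut R) : R →+* TwistedPolynomial R τ :=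
  (TwistedPowerSeries.C τ).codRestrict _
    fun a => ⟨0, fun n hn => by simp [TwistedPowerSeries.coeff_C, hn.ne']⟩

/-- The variable of `R[τ]`. -/
def X (τ : RingAut R) : TwistedPolynomial R τ :=
  ⟨TwistedPowerSeries.mk τ fun n => if n = 1 then 1 else 0,
    ⟨1, fun n hn => by simp [hn.ne']⟩⟩

/-- The anti-homomorphism `* : R[τ] → R[σ]`, `σ = τ⁻¹`,
`(∑ f_i τ^i)^* = ∑ f_i^{(-i)} σ^i`. -/
def adjoint (f : TwistedPolynomial R τ) : TwistedPolynomial R τ⁻¹ :=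
  ⟨TwistedPowerSeries.mk τ⁻¹ fun i => (τ ^ (-(i : ℤ))) (coeff i f), by
    obtain ⟨d, hd⟩ := f.2
    exact ⟨d, fun n hn => by simp [coeff, hd n hn]⟩⟩

end TwistedPolynomial

/-! ### Drinfeld modules over Tate algebras -/

/-- A Drinfeld `A[t_1, …, t_s]`-module of rank `r ≥ 1` over `𝕋_s`: a homomorphism of
`Fq[t_1, …, t_s]`-algebras `φ : A[t_1, …, t_s] → 𝕋_s[τ]`, `a ↦ φ_a`, such that
`φ_θ = θ + A_1 τ + ⋯ + A_r τ^r` with `A_r ≠ 0`. -/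
structure DrinfeldModule (Fq : Type*) [Field Fq] [Fintype Fq] (s r : ℕ) where
  /-- the ring homomorphism `a ↦ φ_a` -/
  toHom : MvPolynomial (Fin s) (Polynomial Fq) →+* TwistedPolynomial (Tate Fq s) (tau Fq s)
  map_const : ∀ c : MvPolynomial (Fin s) Fq,
    toHom (ofFqts Fq s c) = TwistedPolynomial.C _ (ofAts Fq s (ofFqts Fq s c))
  rank_pos : 1 ≤ r
  coeff_zero : (toHom (thetaA Fq s)).coeff 0 = theta Fq s
  coeff_rank : (toHom (thetaA Fq s)).coeff r ≠ 0
  coeff_of_lt : ∀ k, r < k → (toHom (thetaA Fq s)).coeff k = 0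

namespace DrinfeldModule

variable {Fq : Type*} [Field Fq] [Fintype Fq] {s r : ℕ} (φ : DrinfeldModule Fq s r)

/-- The coefficient `A_k` of `φ_θ = θ + A_1 τ + ⋯ + A_r τ^r`. -/
def A (k : ℕ) : Tate Fq s := (φ.toHom (thetaA Fq s)).coeff k

/-- A twisted power series `e` is an exponential series of `φ` if it has constant term `1` and
`e a = φ_a e` for all `a ∈ A[t_1, …, t_s]`. -/
def IsExponential (e : TwistedPowerSeries (Tate Fq s) (tau Fq s)) : Prop :=
  e.coeff 0 = 1 ∧ ∀ a, e * TwistedPowerSeries.C _ (ofAts Fq s a) = (φ.toHom a).1 * e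

lemma tau_const (x : CInfty Fq) :
    tau Fq s (Tate.const Fq s x) = Tate.const Fq s (x ^ Fintype.card Fq) := by
  refine Subtype.ext ?_
  change MvPowerSeries.map _ (MvPowerSeries.C x) = MvPowerSeries.C _
  rw [MvPowerSeries.map_C, ← frob_apply]
  rfl

lemma tau_var (i : Fin s) : tau Fq s (Tate.var Fq s i) = Tate.var Fq s i :=
  Subtype.ext (MvPowerSeries.map_X _ _)

lemma tau_ofFqts (c : MvPolynomial (Fin s) Fq) :
    tau Fq s (ofAts Fq s (ofFqts Fq s c)) = ofAts Fq s (ofFqts Fq s c) := by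
  induction c using MvPolynomial.induction_on with
  | C a =>
    simp [ofAts, ofFqts, tau_const, ← map_pow, FiniteField.pow_card]
  | add p q hp hq => simp only [map_add, hp, hq]
  | mul_X p i hp =>
    simp only [map_mul, hp]
    congr 1
    simp [ofAts, ofFqts, tau_var]

lemma theta_eq : theta Fq s = Tate.const Fq s (ofK Fq RatFunc.X) := by
  simp [theta, ofAts, thetaA, ofA]

lemma tau_pow_theta (n : ℕ) : (tau Fq s ^ n) (theta Fq s) =
    Tate.const Fq s (ofK Fq RatFunc.X ^ (Fintype.card Fq ^ n)) := by
  induction n with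
  | zero => simp [theta_eq]
  | succ n ih => rw [pow_succ', RingAut.mul_apply, ih, tau_const, ← pow_mul, ← pow_succ]

/-- `[n] = θ^{q^n} - θ` is a unit of `𝕋_s` for `n ≥ 1`. -/
lemma isUnit_bracket {n : ℕ} (hn : n ≠ 0) :
    IsUnit ((tau Fq s ^ n) (theta Fq s) - theta Fq s) := by
  rw [tau_pow_theta, theta_eq, ← map_sub]
  refine (IsUnit.mk0 _ fun h => ?_).map _
  have h1 : ‖ofK Fq RatFunc.X‖ = Fintype.card Fq := by rw [norm_ofK, absInfty_X]
  have h2 := congrArg norm (sub_eq_zero.mp h)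
  have h3 : (1 : ℝ) < Fintype.card Fq := by exact_mod_cast Fintype.one_lt_card
  rw [norm_pow, h1] at h2
  have h4 := (pow_right_injective₀ (by positivity) h3.ne') (h2.trans (pow_one _).symm)
  exact (Nat.one_lt_pow hn Fintype.one_lt_card).ne' h4

/-- The recursion for the coefficients of the exponential series. -/
def expAux : ℕ → Tate Fq s
  | 0 => 1
  | n + 1 => Ring.inverse ((tau Fq s ^ (n + 1)) (theta Fq s) - theta Fq s) *
      ∑ i : Fin (n + 1), φ.A (n + 1 - i) * (tau Fq s ^ (n + 1 - (i : ℕ))) (expAux i)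

lemma coeff_phi_mul (e : TwistedPowerSeries (Tate Fq s) (tau Fq s)) (n : ℕ) :
    ((φ.toHom (thetaA Fq s)).1 * e).coeff n = theta Fq s * e.coeff n +
      ∑ i : Fin n, φ.A (n - i) * (tau Fq s ^ (n - (i : ℕ))) (e.coeff i) := by
  have h0 : TwistedPowerSeries.coeff 0 (φ.toHom (thetaA Fq s)).1 = theta Fq s := φ.coeff_zero
  rw [TwistedPowerSeries.coeff_mul, Finset.Nat.sum_antidiagonal_eq_sum_range_succ
    (f := fun i j => TwistedPowerSeries.coeff i (φ.toHom (thetaA Fq s)).1 *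
      (tau Fq s ^ i) (TwistedPowerSeries.coeff j e)), ← Finset.sum_range_reflect,
    Finset.sum_range_succ, add_comm]
  congr 1
  · simp [h0]
  · rw [Finset.sum_range]
    refine Finset.sum_congr rfl fun i _ => ?_
    have hi := i.2
    rw [show n + 1 - 1 - (i : ℕ) = n - i by omega, show n - (n - (i : ℕ)) = i by omega]
    rfl

theorem existsUnique_exponential : ∃! e, φ.IsExponential e := by
  have hθ (e : TwistedPowerSeries (Tate Fq s) (tau Fq s)) (n : ℕ) :
      (e * TwistedPowerSeries.C _ (theta Fq s)).coeff n = ((φ.toHom (thetaA Fq s)).1 * e).coeff n ↔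
      ((tau Fq s ^ n) (theta Fq s) - theta Fq s) * e.coeff n =
        ∑ i : Fin n, φ.A (n - i) * (tau Fq s ^ (n - (i : ℕ))) (e.coeff i) := by
    rw [coeff_phi_mul, TwistedPowerSeries.coeff_mul_C, sub_mul, sub_eq_iff_eq_add',
      mul_comm (TwistedPowerSeries.coeff n e)]
  refine ⟨TwistedPowerSeries.mk _ φ.expAux, ⟨by simp [expAux], fun a => ?_⟩, fun e he => ?_⟩
  · set e := TwistedPowerSeries.mk (tau Fq s) φ.expAux with he
    have hconst (c : MvPolynomial (Fin s) Fq) :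
        e * TwistedPowerSeries.C _ (ofAts Fq s (ofFqts Fq s c)) =
          (φ.toHom (ofFqts Fq s c)).1 * e := by
      rw [φ.map_const]
      refine TwistedPowerSeries.ext fun n => ?_
      change _ = TwistedPowerSeries.coeff n (TwistedPowerSeries.C (tau Fq s) _ * e)
      rw [TwistedPowerSeries.coeff_mul_C, TwistedPowerSeries.coeff_C_mul, mul_comm]
      congr 1
      induction n with
      | zero => simp
      | succ n ih => rw [pow_succ, RingAut.mul_apply, tau_ofFqts, ih]
    have htheta : e * TwistedPowerSeries.C _ (ofAts Fq s (thetaA Fq s)) =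
        (φ.toHom (thetaA Fq s)).1 * e := by
      refine TwistedPowerSeries.ext fun n => ?_
      refine (hθ e n).mpr ?_
      cases n with
      | zero => simp
      | succ n =>
        rw [show TwistedPowerSeries.coeff (n + 1) e = φ.expAux (n + 1) from rfl, expAux,
          ← mul_assoc, Ring.mul_inverse_cancel _ (isUnit_bracket n.succ_ne_zero), one_mul]
        rfl
    have hadd (a b) (ha : e * TwistedPowerSeries.C _ (ofAts Fq s a) = (φ.toHom a).1 * e)
        (hb : e * TwistedPowerSeries.C _ (ofAts Fq s b) = (φ.toHom b).1 * e) :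
        e * TwistedPowerSeries.C _ (ofAts Fq s (a + b)) = (φ.toHom (a + b)).1 * e := by
      rw [map_add, map_add, mul_add, ha, hb, map_add, Subring.coe_add, add_mul]
    have hmul (a b) (ha : e * TwistedPowerSeries.C _ (ofAts Fq s a) = (φ.toHom a).1 * e)
        (hb : e * TwistedPowerSeries.C _ (ofAts Fq s b) = (φ.toHom b).1 * e) :
        e * TwistedPowerSeries.C _ (ofAts Fq s (a * b)) = (φ.toHom (a * b)).1 * e := by
      rw [map_mul, map_mul, ← mul_assoc, ha, mul_assoc, hb, map_mul, Subring.coe_mul, mul_assoc]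
    induction a using MvPolynomial.induction_on with
    | C a =>
      induction a using Polynomial.induction_on with
      | C c => simpa [ofFqts] using hconst (MvPolynomial.C c)
      | add p q hp hq => rw [map_add]; exact hadd _ _ hp hq
      | monomial n c h =>
        rw [pow_succ, ← mul_assoc, map_mul MvPolynomial.C]
        exact hmul _ _ h htheta
    | add p q hp hq => exact hadd _ _ hp hq
    | mul_X p i hp =>
      refine hmul _ _ hp ?_
      simpa [ofFqts] using hconst (MvPolynomial.X i)
  · refine TwistedPowerSeries.ext fun n => ?_
    induction n using Nat.strong_induction_on with
    | _ n ih =>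
      cases n with
      | zero => rw [he.1]; simp [expAux]
      | succ n =>
        have h := (hθ e (n + 1)).mp (congrArg (TwistedPowerSeries.coeff (n + 1))
          (he.2 (thetaA Fq s)))
        refine (isUnit_bracket (Fq := Fq) (s := s) n.succ_ne_zero).mul_left_cancel ?_
        rw [h, TwistedPowerSeries.coeff_mk, expAux, ← mul_assoc,
          Ring.mul_inverse_cancel _ (isUnit_bracket n.succ_ne_zero), one_mul]
        exact Finset.sum_congr rfl fun i _ => by rw [ih i i.2]; rfl

/-- The exponential series `exp_φ = ∑ α_i τ^i` of `φ`. -/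
def expSeries : TwistedPowerSeries (Tate Fq s) (tau Fq s) := φ.existsUnique_exponential.choose

theorem isExponential_expSeries : φ.IsExponential φ.expSeries :=
  φ.existsUnique_exponential.choose_spec.1

/-- The terms `α_i f^{(i)}` of the series that defines `exp_φ(f)`. -/
def expTerm (f : Tate Fq s) (i : ℕ) : Tate Fq s := φ.expSeries.coeff i * (tau Fq s ^ i) f

/-- The exponential function `exp_φ(f) = ∑ α_i f^{(i)}` of `φ`. -/
def exp (f : Tate Fq s) : Tate Fq s := ∑' i, φ.expTerm f i

/-- `φ` is uniformizable if `exp_φ : 𝕋_s → 𝕋_s` is surjective. -/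
def Uniformizable : Prop := Function.Surjective φ.exp

/-! ### Frobenius modules and rigid analytic trivializations -/

/-- The Frobenius module `H(φ) = 𝕋_s[σ]`, `σ = τ⁻¹`. -/
abbrev FrobeniusModule (_φ : DrinfeldModule Fq s r) : Type _ :=
  TwistedPolynomial (Tate Fq s) (tau Fq s)⁻¹

/-- The action of `𝕋_s[z]` on `H(φ)`: `(∑ c_k z^k) · h = ∑ c_k h (φ_θ^*)^k`. -/
def zAction (c : Polynomial (Tate Fq s)) (h : φ.FrobeniusModule) : φ.FrobeniusModule :=
  c.sum fun k a => TwistedPolynomial.C _ a * h * (φ.toHom (thetaA Fq s)).adjoint ^ k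

/-- The map `ι(h_1, …, h_r) = h_1 · 1 + h_2 · σ + ⋯ + h_r · σ^{r-1}` from `𝕋_s[z]^r` to `H(φ)`
given by the `𝕋_s[z]`-basis `1, σ, …, σ^{r-1}` of `H(φ)`. -/
def frameMap (h : Fin r → Polynomial (Tate Fq s)) : φ.FrobeniusModule :=
  ∑ j, φ.zAction (h j) (TwistedPolynomial.X _ ^ (j : ℕ))

/-- The matrix `Φ` that represents multiplication by `σ` on `H(φ)` with respect to the basis
`1, σ, …, σ^{r-1}`: its first `r - 1` rows are the rows `2, …, r` of the identity matrix, and its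
last row is `((z - θ)/A_r^{(-r)}, -A_1^{(-1)}/A_r^{(-r)}, …, -A_{r-1}^{(-r+1)}/A_r^{(-r)})`.
It is meant for `A_r` a unit of `𝕋_s`. -/
def frameMatrix : Matrix (Fin r) (Fin r) (Polynomial (Tate Fq s)) := fun i j =>
  if (i : ℕ) + 1 < r then
    if (j : ℕ) = i + 1 then 1 else 0
  else
    Polynomial.C (Ring.inverse ((tau Fq s ^ (-(r : ℤ))) (φ.A r))) *
      if (j : ℕ) = 0 then Polynomial.X - Polynomial.C (theta Fq s)
      else -Polynomial.C ((tau Fq s ^ (-(j : ℤ))) (φ.A j))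

/-- A rigid analytic trivialization `(ι, Φ, Ψ)` of `φ`: the pair `(ι, Φ)` is the `z`-frame given by
the basis `1, σ, …, σ^{r-1}` of `H(φ)`, and `Ψ ∈ GL_r(𝕋_s{z/θ})` satisfies `Ψ^{(-1)} = Φ Ψ`, where
twisting acts on the coefficients of power series in `z`. -/
structure RigidAnalyticTrivialization where
  /-- the map `ι : 𝕋_s[z]^r → H(φ)` -/
  iota : (Fin r → Polynomial (Tate Fq s)) → φ.FrobeniusModule
  /-- the matrix `Φ` of multiplication by `σ` -/
  Phi : Matrix (Fin r) (Fin r) (Polynomial (Tate Fq s))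
  /-- the trivializing matrix `Ψ` -/
  Psi : Matrix.GeneralLinearGroup (Fin r) (TateZ (theta Fq s))
  iota_eq : iota = φ.frameMap
  Phi_eq : Phi = φ.frameMatrix
  twist_Psi : Psi.1.map (fun f => PowerSeries.map (tau Fq s)⁻¹.toRingHom f.1) =
    Phi.map (fun f => (f : PowerSeries (Tate Fq s))) * Psi.1.map (fun f => f.1)

end DrinfeldModule

end DrinfeldTate

end

/-!
Solve `w = w^{(-1)} Φ + (f, 0, …, 0)` with `w` a row over `𝕋_s{z/θ}`: multiplying by `Ψ` turns the
system into Artin–Schreier equations `y - y^{(-1)} = g`, which are solvable in `𝕋_s{z/θ}`. Because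
`Φ` is the companion matrix of multiplication by `σ` on `H(φ)`, eliminating all but the last entry
`w_r` and putting `P = w_r^{(-1)} / A_r^{(-r)} = ∑ P_n z^n` leaves `φ_θ(P) = zP + f`. So
`f, P_0, P_1, …` is a sequence of successive `θ`-division points of `f` that tends to `0`. As
`exp_φ` is a contractive perturbation of the identity near `0`, some `P_n` is in its image, and
`exp_φ(θ g) = φ_θ(exp_φ(g))` carries this back to `f`.
-/

noncomputable section

namespace DrinfeldTate

namespace TwistedPowerSeries

variable {R : Type*} [CommRing R] {τ : RingAut R}

lemma coeff_polynomial_mul {P : TwistedPowerSeries R τ} {d : ℕ} (hP : ∀ n, d < n → coeff n P = 0)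
    (e : TwistedPowerSeries R τ) (n : ℕ) : coeff n (P * e) =
      ∑ j ∈ Finset.range (d + 1), if j ≤ n then coeff j P * (τ ^ j) (coeff (n - j) e) else 0 := by
  rw [coeff_mul, Finset.Nat.sum_antidiagonal_eq_sum_range_succ_mk]
  calc _ = ∑ j ∈ Finset.range (n + 1),
          if j ≤ n then coeff j P * (τ ^ j) (coeff (n - j) e) else 0 :=
        Finset.sum_congr rfl fun j hj => (if_pos (Finset.mem_range_succ_iff.mp hj)).symm
    _ = ∑ j ∈ Finset.range (n + d + 1),
          if j ≤ n then coeff j P * (τ ^ j) (coeff (n - j) e) else 0 :=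
        Finset.sum_subset (Finset.range_mono (by lia)) fun j _ hj =>
          if_neg fun h => hj (Finset.mem_range_succ_iff.mpr h)
    _ = _ := by
        refine (Finset.sum_subset (Finset.range_mono (by lia)) fun j _ hj => ?_).symm
        rw [Finset.mem_range_succ_iff, not_le] at hj
        rw [hP j hj, zero_mul, ite_self]

variable [TopologicalSpace R]

/-- The value `∑ e_i τ^i(f)` at `f` of the additive operator on `R` that the twisted power series
`e = ∑ e_i τ^i` stands for; it is a junk value where this sum does not converge. -/
def eval (e : TwistedPowerSeries R τ) (f : R) : R := ∑' i, coeff i e * (τ ^ i) f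

lemma eval_eq_sum_range {e : TwistedPowerSeries R τ} {d : ℕ} (he : ∀ n, d < n → coeff n e = 0)
    (f : R) : eval e f = ∑ j ∈ Finset.range (d + 1), coeff j e * (τ ^ j) f :=
  tsum_eq_sum fun n hn => by
    rw [Finset.mem_range_succ_iff, not_le] at hn
    rw [he n hn, zero_mul]

lemma eval_mul_C (e : TwistedPowerSeries R τ) (a f : R) : eval (e * C τ a) f = eval e (a * f) :=
  tsum_congr fun n => by rw [coeff_mul_C, map_mul, mul_assoc]

lemma eval_polynomial_mul [IsTopologicalRing R] [T2Space R] (hτ : Continuous τ)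
    {P : TwistedPowerSeries R τ} {d : ℕ} (hP : ∀ n, d < n → coeff n P = 0)
    {e : TwistedPowerSeries R τ} {f : R} (he : Summable fun i => coeff i e * (τ ^ i) f) :
    eval (P * e) f = eval P (eval e f) := by
  have continuous_pow (j : ℕ) : Continuous (τ ^ j) := by
    induction j with
    | zero => exact continuous_id
    | succ j ih => exact ih.comp hτ
  have hasSum_term (j : ℕ) : HasSum
      (fun n => (if j ≤ n then coeff j P * (τ ^ j) (coeff (n - j) e) else 0) * (τ ^ n) f)
      (coeff j P * (τ ^ j) (eval e f)) := by
    rw [← hasSum_nat_add_iff' j, Finset.sum_eq_zero, sub_zero]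
    · refine ((he.hasSum.map (τ ^ j) (continuous_pow j)).mul_left (coeff j P)).congr_fun fun n => ?_
      rw [if_pos (Nat.le_add_left j n), Nat.add_sub_cancel, Function.comp_apply, map_mul, mul_assoc,
        ← RingAut.mul_apply, ← pow_add, add_comm j]
    · intro n hn
      rw [if_neg (Finset.mem_range.mp hn).not_ge, zero_mul]
  rw [eval_eq_sum_range hP]
  refine HasSum.tsum_eq ?_
  simp only [coeff_polynomial_mul hP, Finset.sum_mul]
  exact hasSum_sum fun j _ => hasSum_term j

end TwistedPowerSeries

section Twist

variable {R : Type*} [CommRing R]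

/-- The automorphism `∑ a_n z^n ↦ ∑ τ(a_n) z^n` of `R⟦z⟧` induced by an automorphism `τ` of `R`. -/
def twist : RingAut R →* RingAut (PowerSeries R) where
  toFun τ := RingEquiv.ofRingHom (PowerSeries.map τ.toRingHom) (PowerSeries.map τ.symm.toRingHom)
    (by ext; simp) (by ext; simp)
  map_one' := by ext; simp
  map_mul' _ _ := by ext; simp

lemma coeff_twist (τ : RingAut R) (n : ℕ) (f : PowerSeries R) :
    PowerSeries.coeff n (twist τ f) = τ (PowerSeries.coeff n f) :=
  PowerSeries.coeff_map τ.toRingHom n f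

lemma twist_C (τ : RingAut R) (a : R) : twist τ (PowerSeries.C a) = PowerSeries.C (τ a) :=
  PowerSeries.map_C τ.toRingHom a

end Twist

section LinearSystem

open Matrix

lemma map_comp_vecMul {m n R S : Type*} [Fintype m] [Semiring R] [Semiring S] (g : R →+* S)
    (u : m → R) (M : Matrix m n R) : g ∘ (u ᵥ* M) = (g ∘ u) ᵥ* M.map g :=
  funext (g.map_vecMul M u)

lemma exists_map_eq_vecMul_add_of_map_eq_mul {n R S : Type*} [Fintype n] [DecidableEq n]
    [CommRing R] [CommRing S] (ι : R →+* S) (σ : S →+* S) (Ψ : GL n R) {Φ : Matrix n n S}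
    (hΨ : (Ψ.1.map ι).map σ = Φ * Ψ.1.map ι) (hσ : ∀ g, ∃ y, ι y - σ (ι y) = ι g) (v : n → R) :
    ∃ w : n → R, ι ∘ w = (σ ∘ ι ∘ w) ᵥ* Φ + ι ∘ v := by
  choose y hy using fun j => hσ ((v ᵥ* Ψ.1) j)
  have vecMul_inv : (y ᵥ* (Ψ⁻¹).1) ᵥ* Ψ.1 = y := by
    rw [vecMul_vecMul, Units.inv_mul, vecMul_one]
  set w := y ᵥ* (Ψ⁻¹).1
  refine ⟨w, vecMul_injective_of_isUnit (Ψ.isUnit.map ι.mapMatrix) ?_⟩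
  calc (ι ∘ w) ᵥ* Ψ.1.map ι = σ ∘ ι ∘ y + ι ∘ (v ᵥ* Ψ.1) := by
        rw [← map_comp_vecMul, vecMul_inv]
        exact funext fun j => sub_eq_iff_eq_add'.mp (hy j)
    _ = (σ ∘ ι ∘ w) ᵥ* (Φ * Ψ.1.map ι) + (ι ∘ v) ᵥ* Ψ.1.map ι := by
        rw [← hΨ, ← map_comp_vecMul, ← map_comp_vecMul, ← map_comp_vecMul, vecMul_inv]
    _ = ((σ ∘ ι ∘ w) ᵥ* Φ + ι ∘ v) ᵥ* Ψ.1.map ι := by rw [add_vecMul, vecMul_vecMul]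

end LinearSystem

lemma sum_mul_pow_eq_of_companion {S : Type*} [CommRing S] (T : RingAut S) {m : ℕ} {B : ℕ → S}
    {w : Fin (m + 1) → S} {P x f : S} (w_zero : w 0 = P * (x - B 0) + f)
    (w_succ : ∀ j : Fin m, w j.succ =
      T⁻¹ (w j.castSucc) - P * (T ^ (-((j + 1 : ℕ) : ℤ))) (B (j + 1)))
    (w_last : P * (T ^ (-((m + 1 : ℕ) : ℤ))) (B (m + 1)) = T⁻¹ (w (Fin.last m))) :
    ∑ j ∈ Finset.range (m + 2), B j * (T ^ j) P = x * P + f := by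
  have pow_inv (j : ℕ) (y : S) : (T ^ (j + 1)) (T⁻¹ y) = (T ^ j) y := by
    rw [← RingAut.mul_apply, pow_succ, mul_inv_cancel_right]
  have pow_zpow_neg (k : ℕ) (y : S) : (T ^ k) ((T ^ (-(k : ℤ))) y) = y := by
    rw [zpow_neg, zpow_natCast, ← RingAut.mul_apply, mul_inv_cancel, RingAut.one_apply]
  have partial_sum (j : Fin (m + 1)) :
      ∑ k ∈ Finset.range (j + 1), B k * (T ^ k) P = x * P + f - (T ^ (j : ℕ)) (w j) := by
    induction j using Fin.induction with
    | zero =>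
      simp only [Fin.val_zero, zero_add, Finset.sum_range_one, pow_zero, RingAut.one_apply, w_zero]
      ring
    | succ j ih =>
      rw [Fin.val_castSucc] at ih
      rw [Fin.val_succ, Finset.sum_range_succ, ih, w_succ, map_sub, map_mul, pow_inv, pow_zpow_neg]
      ring
  rw [Finset.sum_range_succ, ← Fin.val_last m, partial_sum, ← pow_inv, ← w_last, Fin.val_last,
    map_mul, pow_zpow_neg]
  ring

lemma mul_pow_pow_le_of_one_le_pow_mul {q r k : ℕ} {B l : ℝ} (hq : 1 < q) (hB : 1 ≤ B)
    (hl0 : 0 ≤ l) (hl1 : l ≤ 1) (hl : 1 ≤ l ^ r * q) (hk : k ≠ 0) (hkr : k ≤ r) (i : ℕ) :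
    B * (B ^ (q ^ i - 1) * (l ^ i) ^ q ^ i) ^ q ^ k ≤
      (q : ℝ) ^ q ^ (i + k) * (B ^ (q ^ (i + k) - 1) * (l ^ (i + k)) ^ q ^ (i + k)) := by
  have exponent_le : 1 + (q ^ i - 1) * q ^ k ≤ q ^ (i + k) - 1 := by
    have one_lt : 1 < q ^ k := Nat.one_lt_pow hk hq
    have le_mul : 1 * q ^ k ≤ q ^ i * q ^ k :=
      Nat.mul_le_mul_right _ (Nat.one_le_pow _ _ (by lia))
    rw [pow_add, Nat.sub_mul]
    lia
  have base_le : l ^ i ≤ q * l ^ (i + k) := by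
    have one_le : 1 ≤ l ^ k * q :=
      hl.trans (mul_le_mul_of_nonneg_right (pow_le_pow_of_le_one hl0 hl1 hkr) q.cast_nonneg)
    calc l ^ i ≤ l ^ i * (l ^ k * q) := le_mul_of_one_le_right (by positivity) one_le
      _ = q * l ^ (i + k) := by ring
  calc B * (B ^ (q ^ i - 1) * (l ^ i) ^ q ^ i) ^ q ^ k
      = B ^ (1 + (q ^ i - 1) * q ^ k) * (l ^ i) ^ q ^ (i + k) := by ring
    _ ≤ B ^ (q ^ (i + k) - 1) * (q * l ^ (i + k)) ^ q ^ (i + k) := by gcongr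
    _ = _ := by rw [mul_pow]; ring

section Ultrametric

variable {G : Type*} [NormedAddCommGroup G] [IsUltrametricDist G] [CompleteSpace G]

lemma exists_add_map_eq_of_norm_map_le (E : G →+ G) {K : ℝ≥0} (hK : K < 1) {f : G}
    (hE : ∀ g, ‖g‖ ≤ ‖f‖ → ‖E g‖ ≤ K * ‖g‖) : ∃ g, ‖g‖ ≤ ‖f‖ ∧ g + E g = f := by
  have sub_mem {x y : G} (hx : ‖x‖ ≤ ‖f‖) (hy : ‖y‖ ≤ ‖f‖) : ‖x - y‖ ≤ ‖f‖ := by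
    simpa only [sub_eq_add_neg, norm_neg] using
      (IsUltrametricDist.norm_add_le_max x (-y)).trans (max_le hx (by rwa [norm_neg]))
  have mapsTo : Set.MapsTo (fun g => f - E g) (Metric.closedBall 0 ‖f‖)
      (Metric.closedBall 0 ‖f‖) := by
    intro g hg
    rw [mem_closedBall_zero_iff] at hg ⊢
    refine sub_mem le_rfl (((hE g hg).trans ?_).trans hg)
    exact mul_le_of_le_one_left (norm_nonneg g) (by exact_mod_cast hK.le)
  have contracting : ContractingWith K (mapsTo.restrict _ _ _) := by
    refine ⟨hK, LipschitzWith.of_dist_le_mul fun x y => ?_⟩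
    have hx := mem_closedBall_zero_iff.mp x.2
    have hy := mem_closedBall_zero_iff.mp y.2
    simp only [Subtype.dist_eq, Set.MapsTo.val_restrict_apply, dist_sub_left]
    simpa only [dist_eq_norm, map_sub] using hE _ (sub_mem hx hy)
  obtain ⟨g, hg, fixed, -⟩ := contracting.exists_fixedPoint' Metric.isClosed_closedBall.isComplete
    mapsTo (x := f) (by simp) (edist_ne_top _ _)
  exact ⟨g, mem_closedBall_zero_iff.mp hg, eq_sub_iff_add_eq.mp fixed.symm⟩

end Ultrametric

section ArtinSchreier

variable {G : Type*} [NormedAddCommGroup G] [IsUltrametricDist G] [CompleteSpace G] {F : G →+ G}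
  {q : ℕ}

lemma exists_map_sub_eq_of_norm_lt_one (hq : 1 < q) (hF : ∀ x, ‖F x‖ = ‖x‖ ^ q) {d : G}
    (hd : ‖d‖ < 1) : ∃ x, ‖x‖ ≤ ‖d‖ ∧ F x - x = d := by
  obtain ⟨x, hx, eq⟩ := exists_add_map_eq_of_norm_map_le (-F) (K := ‖d‖₊) hd (f := -d)
    fun g hg => by
      rw [norm_neg] at hg
      calc ‖-F g‖ = ‖g‖ ^ (q - 1) * ‖g‖ := by
            rw [norm_neg, hF, ← pow_succ, Nat.sub_add_cancel hq.le]
        _ ≤ ‖d‖ * ‖g‖ := by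
            gcongr
            exact (pow_le_of_le_one (norm_nonneg g) (hg.trans hd.le)
              (Nat.sub_ne_zero_of_lt hq)).trans hg
  refine ⟨x, by simpa only [norm_neg] using hx, ?_⟩
  rw [← neg_inj, ← eq, AddMonoidHom.neg_apply]
  abel

lemma surjective_map_sub_of_denseRange (hq : 1 < q) (hF : ∀ x, ‖F x‖ = ‖x‖ ^ q)
    (hd : DenseRange fun x => F x - x) : Function.Surjective fun x => F x - x := by
  let H : AddSubgroup G := (F - AddMonoidHom.id G).range
  have isOpen : IsOpen (H : Set G) := by
    refine H.isOpen_of_mem_nhds (g := 0) ?_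
    filter_upwards [Metric.ball_mem_nhds (0 : G) one_pos] with d hd
    obtain ⟨x, -, hx⟩ := exists_map_sub_eq_of_norm_lt_one hq hF (mem_ball_zero_iff.mp hd)
    exact ⟨x, hx⟩
  have range_eq : Set.range (fun x => F x - x) = (H : Set G) := rfl
  rw [← Set.range_eq_univ, ← hd.closure_range, range_eq, (H.isClosed_of_isOpen isOpen).closure_eq]

lemma exists_map_sub_eq_of_surjective (hq : 1 < q) (hF : ∀ x, ‖F x‖ = ‖x‖ ^ q)
    (hs : Function.Surjective fun x => F x - x) (c : G) :
    ∃ x, F x - x = c ∧ (‖c‖ < 1 → ‖x‖ ≤ ‖c‖) := by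
  by_cases hc : ‖c‖ < 1
  · obtain ⟨x, hx, eq⟩ := exists_map_sub_eq_of_norm_lt_one hq hF hc
    exact ⟨x, eq, fun _ => hx⟩
  · obtain ⟨x, eq⟩ := hs c
    exact ⟨x, eq, fun h => absurd h hc⟩

end ArtinSchreier

section CInfty

variable (Fq : Type*) [Field Fq] [Fintype Fq]

lemma surjective_frobHom_sub : Function.Surjective fun x => frobHom Fq x - x := by
  have dense : DenseRange fun x => (frobHom Fq : CInfty Fq →+ CInfty Fq) x - x := by
    refine (UniformSpace.Completion.denseRange_coe (α := KInftyBar Fq)).mono ?_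
    rintro _ ⟨b, rfl⟩
    obtain ⟨x, hx⟩ := IsAlgClosed.eval_surjective
      (p := (Polynomial.X ^ Fintype.card Fq - Polynomial.X : Polynomial (KInftyBar Fq)))
      (by rw [FiniteField.X_pow_card_sub_X_natDegree_eq _ Fintype.one_lt_card]
          exact Fintype.card_ne_zero) b
    have root : x ^ Fintype.card Fq - x = b := by simpa using hx
    refine ⟨x, ?_⟩
    calc frobHom Fq x - x
        = UniformSpace.Completion.coeRingHom (α := KInftyBar Fq) (x ^ Fintype.card Fq - x) := by
          rw [frobHom_apply, map_sub, map_pow]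
          rfl
      _ = b := congrArg _ root
  exact surjective_map_sub_of_denseRange Fintype.one_lt_card (norm_frobHom Fq) dense

end CInfty

section Tate

variable {Fq : Type*} [Field Fq] [Fintype Fq] {s : ℕ}

lemma Tate.norm_eq_iSup (f : Tate Fq s) : ‖f‖ = ⨆ ν, ‖MvPowerSeries.coeff ν f.1‖ := by
  simp [Tate.norm_def, MvPowerSeries.gaussNorm]

lemma Tate.norm_coeff_le (f : Tate Fq s) (ν : Fin s →₀ ℕ) :
    ‖MvPowerSeries.coeff ν f.1‖ ≤ ‖f‖ := by
  rw [f.norm_eq_iSup]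
  exact le_ciSup f.tendsto_coeff.bddAbove_range_of_cofinite ν

lemma Tate.norm_le_iff {f : Tate Fq s} {C : ℝ} :
    ‖f‖ ≤ C ↔ ∀ ν, ‖MvPowerSeries.coeff ν f.1‖ ≤ C := by
  rw [f.norm_eq_iSup]
  exact ciSup_le_iff f.tendsto_coeff.bddAbove_range_of_cofinite

instance : CompleteSpace (Tate Fq s) := by
  let _ : TopologicalSpace (Fin s →₀ ℕ) := ⊥
  have : DiscreteTopology (Fin s →₀ ℕ) := ⟨rfl⟩
  let e : Tate Fq s ≃ ZeroAtInftyContinuousMap (Fin s →₀ ℕ) (CInfty Fq) :=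
    { toFun f := ⟨⟨fun ν => MvPowerSeries.coeff ν f.1, continuous_of_discreteTopology⟩, by
        rw [cocompact_eq_cofinite, tendsto_zero_iff_norm_tendsto_zero]
        exact f.tendsto_coeff⟩
      invFun g := ⟨fun ν => g ν, by
        have tendsto_norm := g.zero_at_infty'.norm
        rw [cocompact_eq_cofinite, norm_zero] at tendsto_norm
        exact isRestricted_one_iff.mpr tendsto_norm⟩ }
  have isometry : Isometry e := by
    refine Isometry.of_dist_eq fun f g => ?_
    rw [dist_eq_norm f g, Tate.norm_eq_iSup,
      ← ZeroAtInftyContinuousMap.dist_toBCF_eq_dist, BoundedContinuousFunction.dist_eq_iSup]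
    simp only [dist_eq_norm]
    rfl
  exact (IsometryEquiv.mk e isometry).completeSpace

lemma Tate.norm_const_mul (c : CInfty Fq) (f : Tate Fq s) :
    ‖Tate.const Fq s c * f‖ = ‖c‖ * ‖f‖ := by
  rw [Tate.norm_eq_iSup, Tate.norm_eq_iSup, Real.mul_iSup_of_nonneg (norm_nonneg c)]
  congr! 2 with ν
  rw [← norm_mul]
  exact congrArg norm (MvPowerSeries.coeff_C_mul ν f.1 c)

instance : NormOneClass (Tate Fq s) where
  norm_one := by
    refine le_antisymm (Tate.norm_le_iff.mpr fun ν => ?_) ?_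
    · classical
      rw [OneMemClass.coe_one, MvPowerSeries.coeff_one]
      split_ifs <;> simp
    · simpa using Tate.norm_coeff_le (1 : Tate Fq s) 0

lemma Tate.norm_const (c : CInfty Fq) : ‖Tate.const Fq s c‖ = ‖c‖ := by
  simpa using Tate.norm_const_mul c (1 : Tate Fq s)

lemma norm_theta : ‖theta Fq s‖ = Fintype.card Fq := by
  rw [DrinfeldModule.theta_eq, Tate.norm_const, norm_ofK, absInfty_X]

lemma one_le_norm_theta : 1 ≤ ‖theta Fq s‖ := by
  rw [norm_theta]
  exact_mod_cast Fintype.card_pos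

lemma norm_tau (f : Tate Fq s) : ‖tau Fq s f‖ = ‖f‖ ^ Fintype.card Fq := by
  simp only [Tate.norm_eq_iSup, coeff_tau, norm_pow]
  exact (Real.iSup_pow (fun ν => norm_nonneg _) _).symm

lemma norm_tau_pow (n : ℕ) (f : Tate Fq s) :
    ‖(tau Fq s ^ n) f‖ = ‖f‖ ^ Fintype.card Fq ^ n := by
  induction n with
  | zero => simp
  | succ n ih => rw [pow_succ', RingAut.mul_apply, norm_tau, ih, ← pow_mul, ← pow_succ]

lemma continuous_tau : Continuous (tau Fq s) := by
  refine continuous_of_continuousAt_zero (tau Fq s) ?_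
  rw [ContinuousAt, map_zero, tendsto_zero_iff_norm_tendsto_zero]
  simp only [norm_tau]
  have continuous_norm_pow : Continuous fun f : Tate Fq s => ‖f‖ ^ Fintype.card Fq := by fun_prop
  simpa using continuous_norm_pow.tendsto 0

lemma norm_tau_inv (f : Tate Fq s) :
    ‖(tau Fq s)⁻¹ f‖ = ‖f‖ ^ (Fintype.card Fq : ℝ)⁻¹ := by
  rw [← Real.pow_rpow_inv_natCast (norm_nonneg ((tau Fq s)⁻¹ f)) (Fintype.card_ne_zero (α := Fq)),
    ← norm_tau, ← RingAut.mul_apply, mul_inv_cancel, RingAut.one_apply]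

lemma tendsto_tau_inv {ι : Type*} {l : Filter ι} {f : ι → Tate Fq s} (hf : Tendsto f l (𝓝 0)) :
    Tendsto (fun i => (tau Fq s)⁻¹ (f i)) l (𝓝 0) := by
  rw [tendsto_zero_iff_norm_tendsto_zero] at hf ⊢
  simp only [norm_tau_inv]
  simpa using hf.rpow_const (p := (Fintype.card Fq : ℝ)⁻¹) (Or.inr (by positivity))

lemma norm_tau_pow_theta_sub_theta_mul {n : ℕ} (hn : n ≠ 0) (x : Tate Fq s) :
    ‖((tau Fq s ^ n) (theta Fq s) - theta Fq s) * x‖ =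
      (Fintype.card Fq : ℝ) ^ Fintype.card Fq ^ n * ‖x‖ := by
  have one_lt : (1 : ℝ) < Fintype.card Fq := by exact_mod_cast Fintype.one_lt_card
  have norm_X : ‖ofK Fq RatFunc.X‖ = Fintype.card Fq := by rw [norm_ofK, absInfty_X]
  have lt : ‖-ofK Fq RatFunc.X‖ < ‖ofK Fq RatFunc.X ^ Fintype.card Fq ^ n‖ := by
    rw [norm_neg, norm_pow, norm_X]
    exact lt_self_pow₀ one_lt (Nat.one_lt_pow hn Fintype.one_lt_card)
  rw [DrinfeldModule.tau_pow_theta, DrinfeldModule.theta_eq, ← map_sub, Tate.norm_const_mul,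
    sub_eq_add_neg, IsUltrametricDist.norm_add_eq_max_of_norm_ne_norm lt.ne', max_eq_left lt.le,
    norm_pow, norm_X]

lemma surjective_tau_sub : Function.Surjective fun f : Tate Fq s => tau Fq s f - f := by
  intro c
  choose x hx norm_x using exists_map_sub_eq_of_surjective (F := (frobHom Fq : CInfty Fq →+ _))
    Fintype.one_lt_card (norm_frobHom Fq) (surjective_frobHom_sub Fq)
  refine ⟨⟨fun ν => x (MvPowerSeries.coeff ν c.1), isRestricted_one_iff.mpr ?_⟩, ?_⟩
  · refine squeeze_zero_norm' ?_ c.tendsto_coeff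
    filter_upwards [c.tendsto_coeff.eventually_lt_const one_pos] with ν hν
    rw [norm_norm]
    exact norm_x _ hν
  · refine Subtype.ext (MvPowerSeries.ext fun ν => ?_)
    rw [AddSubgroupClass.coe_sub, map_sub, coeff_tau, ← frobHom_apply]
    exact hx _

lemma exists_sub_tau_inv_eq (c : Tate Fq s) :
    ∃ y, y - (tau Fq s)⁻¹ y = c ∧ (‖c‖ < 1 → ‖y‖ ≤ ‖c‖) := by
  obtain ⟨x, hx, norm_x⟩ := exists_map_sub_eq_of_surjective (F := (tau Fq s : Tate Fq s →+ _))
    Fintype.one_lt_card norm_tau surjective_tau_sub c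
  refine ⟨tau Fq s x, ?_, fun hc => ?_⟩
  · rw [← RingAut.mul_apply, inv_mul_cancel, RingAut.one_apply]
    exact hx
  · rw [norm_tau]
    exact (pow_le_of_le_one (norm_nonneg x) ((norm_x hc).trans hc.le)
      Fintype.card_ne_zero).trans (norm_x hc)

end Tate

section TateZ

variable {Fq : Type*} [Field Fq] [Fintype Fq] {s : ℕ} {c : Tate Fq s}

lemma TateZ.tendsto_norm_coeff_mul (f : TateZ c) :
    Tendsto (fun n => ‖PowerSeries.coeff n f.1‖ * ‖c‖ ^ n) atTop (𝓝 0) := by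
  simpa only [norm_norm] using (PowerSeries.isRestricted_iff' _ _).mp f.2

lemma TateZ.tendsto_coeff (hc : 1 ≤ ‖c‖) (f : TateZ c) :
    Tendsto (fun n => PowerSeries.coeff n f.1) atTop (𝓝 0) :=
  squeeze_zero_norm (fun _ => le_mul_of_one_le_right (norm_nonneg _) (one_le_pow₀ hc))
    f.tendsto_norm_coeff_mul

lemma exists_sub_twist_inv_eq (hc : 1 ≤ ‖c‖) (g : TateZ c) :
    ∃ y : TateZ c, y.1 - twist (tau Fq s)⁻¹ y.1 = g.1 := by
  choose y hy norm_y using exists_sub_tau_inv_eq (Fq := Fq) (s := s)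
  refine ⟨⟨PowerSeries.mk fun n => y (PowerSeries.coeff n g.1), ?_⟩, ?_⟩
  · refine (PowerSeries.isRestricted_iff' _ _).mpr ?_
    refine squeeze_zero_norm' ?_ g.tendsto_norm_coeff_mul
    have small := (tendsto_zero_iff_norm_tendsto_zero.mp (g.tendsto_coeff hc)).eventually_lt_const
      one_pos
    filter_upwards [small] with n hn
    rw [PowerSeries.coeff_mk, norm_mul, norm_norm, norm_pow, norm_norm]
    gcongr
    exact norm_y _ hn
  · ext n : 1
    rw [map_sub, coeff_twist, PowerSeries.coeff_mk, hy]

end TateZ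

namespace DrinfeldModule

/-- The common factor `1 / A_r^{(-r)}` of the last row of `Φ`, with value `0` when `A_r` is not a
unit. -/
def leadInv {Fq : Type*} [Field Fq] [Fintype Fq] {s r : ℕ} (φ : DrinfeldModule Fq s r) :
    Tate Fq s :=
  Ring.inverse ((tau Fq s ^ (-(r : ℤ))) (φ.A r))

section FrameMatrix

open Matrix

variable {Fq : Type*} [Field Fq] [Fintype Fq] {s m : ℕ} (φ : DrinfeldModule Fq s (m + 1))
  (u : Fin (m + 1) → PowerSeries (Tate Fq s))

lemma vecMul_frameMatrix_zero :
    (u ᵥ* φ.frameMatrix.map (↑)) 0 =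
      u (Fin.last m) * PowerSeries.C φ.leadInv * (PowerSeries.X - PowerSeries.C (theta Fq s)) := by
  rw [vecMul_eq_sum, Finset.sum_apply, Fin.sum_univ_castSucc, Finset.sum_eq_zero, zero_add]
  · simp [frameMatrix, leadInv, mul_assoc]
  · simp [frameMatrix]

lemma vecMul_frameMatrix_succ (j : Fin m) :
    (u ᵥ* φ.frameMatrix.map (↑)) j.succ = u j.castSucc -
      u (Fin.last m) * PowerSeries.C φ.leadInv *
        PowerSeries.C ((tau Fq s ^ (-((j + 1 : ℕ) : ℤ))) (φ.A (j + 1))) := by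
  rw [vecMul_eq_sum, Finset.sum_apply, Fin.sum_univ_castSucc, Finset.sum_eq_single j,
    sub_eq_add_neg]
  · simp [frameMatrix, leadInv, mul_assoc]
  · intro i _ hi
    have ne : (j : ℕ) ≠ i := fun h => hi (Fin.ext h.symm)
    simp [frameMatrix, ne]
  · simp

end FrameMatrix

section Exponential

variable {Fq : Type*} [Field Fq] [Fintype Fq] {s r : ℕ} (φ : DrinfeldModule Fq s r)

/-- A common bound for `1` and for the norms of the coefficients of `φ_θ`, in terms of which the
coefficients of `exp_φ` are estimated. -/
def coeffBound : ℝ := 1 + ∑ k ∈ Finset.range (r + 1), ‖φ.A k‖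

lemma one_le_coeffBound : 1 ≤ φ.coeffBound :=
  le_add_of_nonneg_right (Finset.sum_nonneg fun _ _ => norm_nonneg _)

lemma norm_A_le_coeffBound {k : ℕ} (hk : k ≤ r) : ‖φ.A k‖ ≤ φ.coeffBound :=
  (Finset.single_le_sum (f := fun k => ‖φ.A k‖) (fun _ _ => norm_nonneg _)
    (Finset.mem_range_succ_iff.mpr hk)).trans (le_add_of_nonneg_left zero_le_one)

lemma tau_pow_theta_sub_theta_mul_coeff_expSeries (n : ℕ) :
    ((tau Fq s ^ n) (theta Fq s) - theta Fq s) * φ.expSeries.coeff n =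
      ∑ i : Fin n, φ.A (n - i) * (tau Fq s ^ (n - (i : ℕ))) (φ.expSeries.coeff i) := by
  have coeff_eq := congrArg (TwistedPowerSeries.coeff n)
    (φ.isExponential_expSeries.2 (thetaA Fq s))
  rw [coeff_phi_mul, TwistedPowerSeries.coeff_mul_C] at coeff_eq
  rw [sub_mul, sub_eq_iff_eq_add', ← coeff_eq, mul_comm]
  rfl

lemma norm_coeff_expSeries_le {l : ℝ} (hl0 : 0 ≤ l) (hl1 : l ≤ 1)
    (hl : 1 ≤ l ^ r * Fintype.card Fq) (n : ℕ) :
    ‖φ.expSeries.coeff n‖ ≤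
      φ.coeffBound ^ (Fintype.card Fq ^ n - 1) * (l ^ n) ^ Fintype.card Fq ^ n := by
  have one_le := φ.one_le_coeffBound
  induction n using Nat.strong_induction_on with
  | _ n ih =>
    rcases eq_or_ne n 0 with rfl | hn
    · simp [φ.isExponential_expSeries.1]
    have card_pow_pos : (0 : ℝ) < (Fintype.card Fq : ℝ) ^ Fintype.card Fq ^ n := by positivity
    refine le_of_mul_le_mul_left ?_ card_pow_pos
    rw [← norm_tau_pow_theta_sub_theta_mul hn, tau_pow_theta_sub_theta_mul_coeff_expSeries]
    refine IsUltrametricDist.norm_sum_le_of_forall_le_of_nonneg (by positivity) fun i _ => ?_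
    obtain hkr | hkr := lt_or_ge r (n - i)
    · rw [A, φ.coeff_of_lt _ hkr, zero_mul, norm_zero]
      positivity
    calc ‖φ.A (n - i) * (tau Fq s ^ (n - (i : ℕ))) (φ.expSeries.coeff i)‖
        ≤ φ.coeffBound * (φ.coeffBound ^ (Fintype.card Fq ^ (i : ℕ) - 1) *
            (l ^ (i : ℕ)) ^ Fintype.card Fq ^ (i : ℕ)) ^ Fintype.card Fq ^ (n - (i : ℕ)) := by
          refine (norm_mul_le _ _).trans ?_
          rw [norm_tau_pow]
          gcongr
          · exact φ.norm_A_le_coeffBound hkr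
          · exact ih i i.2
      _ ≤ _ := by
          have := mul_pow_pow_le_of_one_le_pow_mul Fintype.one_lt_card one_le hl0 hl1 hl
            (Nat.sub_ne_zero_of_lt i.2) hkr i
          rwa [Nat.add_sub_cancel' i.2.le] at this

lemma norm_expTerm_le (f : Tate Fq s) (n : ℕ) :
    ‖φ.expTerm f n‖ ≤ ‖φ.expSeries.coeff n‖ * ‖f‖ ^ Fintype.card Fq ^ n :=
  (norm_mul_le _ _).trans_eq (by rw [norm_tau_pow])

theorem summable_expTerm (f : Tate Fq s) : Summable (φ.expTerm f) := by
  have one_lt_card : (1 : ℝ) < Fintype.card Fq := by exact_mod_cast Fintype.one_lt_card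
  have one_le := φ.one_le_coeffBound
  obtain ⟨l, hl0, hl⟩ : ∃ l : ℝ, 0 ≤ l ∧ l ^ r = (Fintype.card Fq : ℝ)⁻¹ :=
    ⟨_, by positivity, Real.rpow_inv_natCast_pow (by positivity)
      (Nat.one_le_iff_ne_zero.mp φ.rank_pos)⟩
  have hl1 : l < 1 := by
    refine lt_of_pow_lt_pow_left₀ r zero_le_one ?_
    rw [hl, one_pow]
    exact inv_lt_one_of_one_lt₀ one_lt_card
  have tendsto : Tendsto (fun n => φ.coeffBound * l ^ n * ‖f‖) atTop (𝓝 0) := by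
    simpa using
      ((tendsto_pow_atTop_nhds_zero_of_lt_one hl0 hl1).const_mul φ.coeffBound).mul_const ‖f‖
  refine NonarchimedeanAddGroup.summable_of_tendsto_cofinite_zero ?_
  rw [Nat.cofinite_eq_atTop]
  refine squeeze_zero_norm' ?_ tendsto
  filter_upwards [tendsto.eventually_le_const one_pos] with n hn
  calc ‖φ.expTerm f n‖
      ≤ φ.coeffBound ^ (Fintype.card Fq ^ n - 1) * (l ^ n) ^ Fintype.card Fq ^ n *
          ‖f‖ ^ Fintype.card Fq ^ n := by
        refine (φ.norm_expTerm_le f n).trans ?_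
        gcongr
        exact φ.norm_coeff_expSeries_le hl0 hl1.le
          (by rw [hl, inv_mul_cancel₀ (by positivity)]) n
    _ ≤ φ.coeffBound ^ Fintype.card Fq ^ n * (l ^ n) ^ Fintype.card Fq ^ n *
          ‖f‖ ^ Fintype.card Fq ^ n := by
        gcongr
        exact Nat.sub_le _ _
    _ = (φ.coeffBound * l ^ n * ‖f‖) ^ Fintype.card Fq ^ n := by rw [mul_pow, mul_pow]
    _ ≤ φ.coeffBound * l ^ n * ‖f‖ := pow_le_of_le_one (by positivity) hn (by positivity)

lemma exp_add (f g : Tate Fq s) : φ.exp (f + g) = φ.exp f + φ.exp g := by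
  rw [exp, exp, exp, ← (φ.summable_expTerm f).tsum_add (φ.summable_expTerm g)]
  simp only [expTerm, map_add, mul_add]

lemma norm_exp_sub_self_le {g : Tate Fq s} (hg : ‖g‖ ≤ (2 * φ.coeffBound)⁻¹) :
    ‖φ.exp g - g‖ ≤ 2⁻¹ * ‖g‖ := by
  have one_le := φ.one_le_coeffBound
  have mul_le : φ.coeffBound * ‖g‖ ≤ 2⁻¹ := by
    calc _ ≤ φ.coeffBound * (2 * φ.coeffBound)⁻¹ := by gcongr
      _ = 2⁻¹ := by field_simp
  have expTerm_zero : φ.expTerm g 0 = g := by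
    rw [expTerm, φ.isExponential_expSeries.1, pow_zero, RingAut.one_apply, one_mul]
  have exp_sub : φ.exp g - g = ∑' n, φ.expTerm g (n + 1) := by
    rw [exp, (φ.summable_expTerm g).tsum_eq_zero_add, expTerm_zero, add_sub_cancel_left]
  rw [exp_sub]
  refine IsUltrametricDist.norm_tsum_le_of_forall_le_of_nonneg (by positivity) fun n => ?_
  obtain ⟨k, hk⟩ : ∃ k, Fintype.card Fq ^ (n + 1) = k + 1 + 1 :=
    Nat.exists_eq_add_of_le' (Nat.one_lt_pow n.succ_ne_zero Fintype.one_lt_card)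
  calc ‖φ.expTerm g (n + 1)‖
      ≤ φ.coeffBound ^ (Fintype.card Fq ^ (n + 1) - 1) * ‖g‖ ^ Fintype.card Fq ^ (n + 1) := by
        refine (φ.norm_expTerm_le g _).trans ?_
        gcongr
        simpa using φ.norm_coeff_expSeries_le zero_le_one le_rfl
          (by simpa using Nat.one_le_iff_ne_zero.mpr Fintype.card_ne_zero) (n + 1)
    _ = (φ.coeffBound * ‖g‖) ^ k * (φ.coeffBound * ‖g‖) * ‖g‖ := by
        rw [hk, Nat.add_sub_cancel]
        ring
    _ ≤ 1 * 2⁻¹ * ‖g‖ := by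
        gcongr
        exact pow_le_one₀ (by positivity) (mul_le.trans (by norm_num))
    _ = 2⁻¹ * ‖g‖ := by rw [one_mul]

lemma exists_exp_eq_of_norm_le {f : Tate Fq s} (hf : ‖f‖ ≤ (2 * φ.coeffBound)⁻¹) :
    ∃ g, φ.exp g = f := by
  obtain ⟨g, -, hg⟩ := exists_add_map_eq_of_norm_map_le
    (AddMonoidHom.mk' (fun g => φ.exp g - g) fun a b => by rw [exp_add]; abel)
    (K := 2⁻¹) (inv_lt_one_of_one_lt₀ one_lt_two) (f := f)
    fun g hg => by simpa using φ.norm_exp_sub_self_le (hg.trans hf)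
  exact ⟨g, by simpa using hg⟩

lemma exp_ofAts_mul (a : MvPolynomial (Fin s) (Polynomial Fq)) (g : Tate Fq s) :
    φ.exp (ofAts Fq s a * g) = (φ.toHom a).1.eval (φ.exp g) := by
  obtain ⟨d, hd⟩ := (φ.toHom a).2
  have exp_eq_eval : φ.exp = φ.expSeries.eval := rfl
  rw [exp_eq_eval, ← TwistedPowerSeries.eval_mul_C, φ.isExponential_expSeries.2]
  exact TwistedPowerSeries.eval_polynomial_mul continuous_tau hd (φ.summable_expTerm g)

/-- A convergent `θ`-division tower over `F 0`: a sequence of successive `θ`-division points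
`φ_θ(F (n + 1)) = F n` that tends to `0`. Such a tower produces a preimage of `F 0` under
`exp_φ`. -/
structure IsConvergentDivisionTower (F : ℕ → Tate Fq s) : Prop where
  eval_succ : ∀ n, (φ.toHom (thetaA Fq s)).1.eval (F (n + 1)) = F n
  tendsto_zero : Tendsto F atTop (𝓝 0)

variable {φ}

lemma IsConvergentDivisionTower.exists_exp_eq {F : ℕ → Tate Fq s}
    (hF : φ.IsConvergentDivisionTower F) : ∃ g, φ.exp g = F 0 := by
  have radius_pos : 0 < (2 * φ.coeffBound)⁻¹ := by
    have := φ.one_le_coeffBound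
    positivity
  obtain ⟨n, hn⟩ := ((tendsto_zero_iff_norm_tendsto_zero.mp hF.tendsto_zero).eventually_le_const
    radius_pos).exists
  have descend {k : ℕ} : (∃ g, φ.exp g = F (k + 1)) → ∃ g, φ.exp g = F k := fun ⟨g, hg⟩ =>
    ⟨theta Fq s * g, (φ.exp_ofAts_mul _ g).trans (hg ▸ hF.eval_succ k)⟩
  exact Nat.decreasingInduction' (P := fun k => ∃ g, φ.exp g = F k) (fun _ _ _ => descend)
    n.zero_le (φ.exists_exp_eq_of_norm_le hn)

end Exponential

section DivisionTower

open Matrix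

variable {Fq : Type*} [Field Fq] [Fintype Fq] {s : ℕ}

lemma sum_mul_twist_pow_eq {m : ℕ} (φ : DrinfeldModule Fq s (m + 1)) (hA : IsUnit (φ.A (m + 1)))
    {f : PowerSeries (Tate Fq s)} {w : Fin (m + 1) → PowerSeries (Tate Fq s)}
    (hw : w = (twist (tau Fq s)⁻¹ ∘ w) ᵥ* φ.frameMatrix.map (↑) + Pi.single 0 f)
    {P : PowerSeries (Tate Fq s)}
    (hP : P = twist (tau Fq s)⁻¹ (w (Fin.last m)) * PowerSeries.C φ.leadInv) :
    ∑ j ∈ Finset.range (m + 2), PowerSeries.C (φ.A j) * (twist (tau Fq s) ^ j) P =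
      PowerSeries.X * P + f := by
  have twist_zpow_C (n : ℤ) (a : Tate Fq s) :
      (twist (tau Fq s) ^ n) (PowerSeries.C a) = PowerSeries.C ((tau Fq s ^ n) a) := by
    rw [← map_zpow, twist_C]
  have A_zero : φ.A 0 = theta Fq s := φ.coeff_zero
  refine sum_mul_pow_eq_of_companion (B := fun j => PowerSeries.C (φ.A j)) (w := w)
    (twist (tau Fq s)) ?_ (fun j => ?_) ?_
  · conv_lhs => rw [hw]
    rw [Pi.add_apply, Pi.single_eq_same, vecMul_frameMatrix_zero, A_zero, hP]
    rfl
  · conv_lhs => rw [hw]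
    rw [Pi.add_apply, Pi.single_eq_of_ne j.succ_ne_zero, add_zero, vecMul_frameMatrix_succ,
      twist_zpow_C, hP, ← map_inv]
    rfl
  · rw [hP, twist_zpow_C, mul_assoc, ← map_mul, leadInv, Ring.inverse_mul_cancel _ (hA.map _),
      map_one, mul_one, map_inv]

variable {r : ℕ} {φ : DrinfeldModule Fq s r}

lemma isConvergentDivisionTower_of_sum_eq {P : PowerSeries (Tate Fq s)} {f : Tate Fq s}
    (hP : ∑ j ∈ Finset.range (r + 1), PowerSeries.C (φ.A j) * (twist (tau Fq s) ^ j) P =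
      PowerSeries.X * P + PowerSeries.C f)
    (tendsto_coeff : Tendsto (fun n => PowerSeries.coeff n P) atTop (𝓝 0)) :
    φ.IsConvergentDivisionTower
      fun n => PowerSeries.coeff n (PowerSeries.X * P + PowerSeries.C f) := by
  have coeff_succ (n : ℕ) :
      PowerSeries.coeff (n + 1) (PowerSeries.X * P + PowerSeries.C f) = PowerSeries.coeff n P := by
    rw [map_add, PowerSeries.coeff_succ_X_mul, PowerSeries.coeff_succ_C, add_zero]
  refine ⟨fun n => ?_, (tendsto_add_atTop_iff_nat 1).mp ?_⟩
  · rw [coeff_succ, TwistedPowerSeries.eval_eq_sum_range φ.coeff_of_lt, ← hP, map_sum]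
    refine Finset.sum_congr rfl fun j _ => ?_
    rw [PowerSeries.coeff_C_mul, ← map_pow, coeff_twist]
    rfl
  · simpa only [coeff_succ] using tendsto_coeff

lemma exists_isConvergentDivisionTower (hA : IsUnit (φ.A r)) {c : Tate Fq s} (hc : 1 ≤ ‖c‖)
    (Ψ : GL (Fin r) (TateZ c))
    (hΨ : Ψ.1.map (fun f => PowerSeries.map (tau Fq s)⁻¹.toRingHom f.1) =
      φ.frameMatrix.map (fun f => (f : PowerSeries (Tate Fq s))) * Ψ.1.map (fun f => f.1))
    (f : Tate Fq s) : ∃ F, F 0 = f ∧ φ.IsConvergentDivisionTower F := by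
  obtain ⟨m, rfl⟩ := Nat.exists_eq_add_of_le' φ.rank_pos
  let ι := (PowerSeries.IsRestricted.subring (R := Tate Fq s) ‖c‖).subtype
  let v : Fin (m + 1) → TateZ c := Pi.single 0 ⟨PowerSeries.C f, PowerSeries.isRestricted_C _ f⟩
  obtain ⟨w, hw⟩ := exists_map_eq_vecMul_add_of_map_eq_mul ι (twist (tau Fq s)⁻¹).toRingHom Ψ hΨ
    (exists_sub_twist_inv_eq hc) v
  have map_v : ι ∘ v = Pi.single (M := fun _ => PowerSeries (Tate Fq s)) 0 (PowerSeries.C f) :=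
    funext (Pi.apply_single (fun _ => ι) (fun _ => map_zero ι) _ _)
  rw [map_v] at hw
  have tendsto_coeff := (tendsto_tau_inv (TateZ.tendsto_coeff hc (w (Fin.last m)))).mul_const
    φ.leadInv
  rw [zero_mul] at tendsto_coeff
  refine ⟨_, ?_, isConvergentDivisionTower_of_sum_eq (sum_mul_twist_pow_eq φ hA hw rfl) ?_⟩
  · simp
  · simp only [PowerSeries.coeff_mul_C, coeff_twist]
    exact tendsto_coeff

end DivisionTower

end DrinfeldModule

end DrinfeldTate

end

theorem theorem4_general {Fq : Type*} [Field Fq] [Fintype Fq] {s r : ℕ}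
    (φ : DrinfeldTate.DrinfeldModule Fq s r) (hA : IsUnit (φ.A r))
    {c : DrinfeldTate.Tate Fq s} (hc : 1 ≤ ‖c‖)
    (Ψ : Matrix.GeneralLinearGroup (Fin r) (DrinfeldTate.TateZ c))
    (hΨ : Ψ.1.map (fun f => PowerSeries.map (DrinfeldTate.tau Fq s)⁻¹.toRingHom f.1) =
      φ.frameMatrix.map (fun f => (f : PowerSeries (DrinfeldTate.Tate Fq s))) *
        Ψ.1.map (fun f => f.1)) :
    (∀ f, Summable (φ.expTerm f)) ∧ φ.Uniformizable := by
  refine ⟨φ.summable_expTerm, fun f => ?_⟩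
  obtain ⟨F, rfl, hF⟩ :=
    DrinfeldTate.DrinfeldModule.exists_isConvergentDivisionTower hA hc Ψ hΨ f
  exact hF.exists_exp_eq

theorem theorem4 {Fq : Type*} [Field Fq] [Fintype Fq] {s r : ℕ}
    (φ : DrinfeldTate.DrinfeldModule Fq s r) (hA : IsUnit (φ.A r))
    (T : φ.RigidAnalyticTrivialization) :
    (∀ f, Summable (φ.expTerm f)) ∧ φ.Uniformizable :=
  theorem4_general φ hA DrinfeldTate.one_le_norm_theta T.Psi (T.Phi_eq ▸ T.twist_Psi)
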